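/- For a set $X$ and binary relations $r,s\subseteq X\times X$ put $$\mathrm D(r)=\{(x,x)\mid \exists y\;(x,y)\in r\},\qquad \mathrm R(r)=\{(y,y)\mid \exists x\;(x,y)\in r\},$$ and let the demonic composition be $$r*s=\{(x,y)\mid \exists w\,\big((x,w)\in r\wedge (w,y)\in s\big)\ \text{and}\ \forall z\,\big((x,z)\in r\Rightarrow (z,z)\in\mathrm D(s)\big)\}.$$ Consider the first-order language (with equality) that has two unary function symbols $\mathrm D,\mathrm R$ and one binary function symbol $*$. A structure for this language is called representable if it is isomorphic to a proper structure, i.e. one whose underlying set is a set of binary relations on some base set $X$, closed under the operations $\mathrm D,\mathrm R,*$ above, with the three symbols interpreted by these operations. Let $R(\mathrm D,\mathrm R,*)$ be the class of representable structures. Theorem. $R(\mathrm D,\mathrm R,*)$ cannot be axiomatised by a finite first-order theory: there is no finite set $T$ of first-order sentences in this language such that a (nonempty) structure $\mathcal S$ is a model of $T$ if and only if $\mathcal S$ is representable. -/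

import Mathlib

open FirstOrder FirstOrder.Language

namespace DomainRange

/-- Function symbols of the signature `{D, R, *}`. -/
inductive Func : ℕ → Type
  | dom : Func 1
  | ran : Func 1
  | comp : Func 2

/-- The first-order language with unary symbols `D`, `R`, a binary symbol `*`, and no relation
symbols besides equality. -/
def lang : FirstOrder.Language.{0, 0} where
  Functions := Func
  Relations := fun _ => Empty

/-- `D(r) = {(x, x) | ∃ y, (x, y) ∈ r}`. -/
def domRel {X : Type*} (r : Set (X × X)) : Set (X × X) :=
  {p | p.1 = p.2 ∧ ∃ y, (p.1, y) ∈ r}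

/-- `R(r) = {(y, y) | ∃ x, (x, y) ∈ r}`. -/
def ranRel {X : Type*} (r : Set (X × X)) : Set (X × X) :=
  {p | p.1 = p.2 ∧ ∃ x, (x, p.2) ∈ r}

/-- Ordinary (angelic) composition `r ; s`. -/
def angelicComp {X : Type*} (r s : Set (X × X)) : Set (X × X) :=
  {p | ∃ y, (p.1, y) ∈ r ∧ (y, p.2) ∈ s}

/-- Demonic composition
`r * s = {(x, y) ∈ r ; s | ∀ z, (x, z) ∈ r → (z, z) ∈ D(s)}`. -/
def demonicComp {X : Type*} (r s : Set (X × X)) : Set (X × X) :=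
  {p | p ∈ angelicComp r s ∧ ∀ z, (p.1, z) ∈ r → (z, z) ∈ domRel s}

/-- All binary relations on `X`, as a `{D, R, *}`-structure under the relational interpretation. -/
instance relStructure (X : Type*) : lang.Structure (Set (X × X)) where
  funMap := fun f =>
    match f with
    | Func.dom => fun v => domRel (v 0)
    | Func.ran => fun v => ranRel (v 0)
    | Func.comp => fun v => demonicComp (v 0) (v 1)
  RelMap := fun e => Empty.elim e

/-- A `{D, R, *}`-structure is representable if it is isomorphic to a proper structure, that is, to
a set of binary relations on some base `X` which is closed under the relational operations
`D`, `R`, `*` and carries their restrictions. The base is taken in the universe of the structure,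
which is no restriction, by the downward Löwenheim–Skolem theorem. -/
def IsRepresentable.{u} (M : Type u) [lang.Structure M] : Prop :=
  ∃ (X : Type u) (P : lang.Substructure (Set (X × X))), Nonempty (M ≃[lang] P)

end DomainRange

/-! ### Local embeddings and ultraproducts. -/

namespace FirstOrder.Language

open Filter Structure

/-! For a map `t` on an index set `A`, `Alg A t` is a finite table of arrows indexed by `A`. In any
representation `f * g = ε` contains the identity on `Z`, so `a i = p i * q i` lies inside `p i * ε *
q i = a (t i)` (`map_a_subset`). Along a nontrivial cycle of `t` these inclusions become equalities,
contradicting faithfulness (`not_isRepresentable_of_cycle`). Conversely, an injective rank in `ℕ`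
that never drops along `t` yields a representation (`isRepresentable_of_rank`).

Take a cycle of length `k + 2` and cut it by making one index a fixed point. The result is
representable, and only products whose left factor carries that index change (`relabel_comp`). Any
`k` elements miss some index, so they embed in a representable structure. Hence an ultraproduct of
the nonrepresentable cyclic structures embeds in an ultraproduct of representable ones. A finite
axiomatisation `T` would hold in the latter, hence in the former since representability passes to
substructures, and by Łoś in some cyclic structure. -/

/-- If all small finite subsets of the structures `M k` embed into structures `N k F`, then an
ultraproduct of the `M k` embeds into an ultraproduct of the `N k F`. -/
theorem exists_ultraproduct_embedding_of_locally {L : Language.{0, 0}} [L.IsAlgebraic]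
    {M : ℕ → Type u} [∀ k, L.Structure (M k)] [∀ k, Nonempty (M k)]
    (U : Ultrafilter ℕ) (hU : (U : Filter ℕ) ≤ atTop)
    (N : ∀ k, Finset (M k) → Type u) [∀ k F, L.Structure (N k F)]
    (h : ∀ k F, M k → N k F)
    (hinj : ∀ k F, F.card ≤ k → Set.InjOn (h k F) F)
    (hmap : ∀ k F, F.card ≤ k → ∀ {n : ℕ} (f : L.Functions n) (v : Fin n → M k),
      (∀ i, v i ∈ F) → funMap f v ∈ F → h k F (funMap f v) = funMap f (h k F ∘ v)) :
    ∃ (ι : Type u) (V : Ultrafilter ι) (s : ι → Σ k, Finset (M k)),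
      Nonempty ((U : Filter ℕ).Product M ↪[L]
        (V : Filter ι).Product fun i => N (s i).1 (s i).2) := by
  classical
  -- The iterated filter takes `F` large first and then `U`-almost every `k` depending on `F`, so a
  -- finite set only has to be small relative to late `k`.
  have : NeBot ((atTop : Filter (Finset ((U : Filter ℕ).Product M))).curry (U : Filter ℕ)) := by
    refine ⟨fun hbot => ?_⟩
    have : ∀ᶠ p in (atTop : Filter (Finset ((U : Filter ℕ).Product M))).curry (U : Filter ℕ),
        False := by rw [hbot]; exact eventually_bot
    rw [eventually_curry_iff] at this
    obtain ⟨F, hF⟩ := this.exists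
    exact hF.exists.elim fun _ => id
  set V := Ultrafilter.of
    ((atTop : Filter (Finset ((U : Filter ℕ).Product M))).curry (U : Filter ℕ)) with hV
  have key : ∀ p : Finset ((U : Filter ℕ).Product M) × ℕ → Prop,
      (∃ F₀, ∀ F, F₀ ⊆ F → ∀ᶠ k in (U : Filter ℕ), p (F, k)) → ∀ᶠ i in (V : Filter _), p i := by
    rintro p ⟨F₀, hp⟩
    refine Ultrafilter.of_le _ ?_
    change ∀ᶠ i in _, p i
    rw [eventually_curry_iff]
    filter_upwards [eventually_ge_atTop F₀] with F hF using hp F hF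
  set rep : (U : Filter ℕ).Product M → ∀ k, M k := Quotient.out with hrep
  have rep_spec : ∀ x, ((rep x : ∀ k, M k) : (U : Filter ℕ).Product M) = x :=
    fun x => Quotient.out_eq x
  set img : Finset ((U : Filter ℕ).Product M) → ∀ k, Finset (M k) :=
    fun F k => F.image fun x => rep x k with himg
  have card_img : ∀ F, ∀ᶠ k in (U : Filter ℕ), (img F k).card ≤ k := by
    intro F
    filter_upwards [hU (eventually_ge_atTop F.card)] with k hk
    exact Finset.card_image_le.trans hk
  have mem_img : ∀ {F x} k, x ∈ F → rep x k ∈ img F k :=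
    fun k hx => Finset.mem_image_of_mem _ hx
  refine ⟨Finset ((U : Filter ℕ).Product M) × ℕ, V, fun i => ⟨i.2, img i.1 i.2⟩, ⟨?_⟩⟩
  set e : (U : Filter ℕ).Product M → ∀ i : Finset ((U : Filter ℕ).Product M) × ℕ,
    N i.2 (img i.1 i.2) := fun x i => h _ _ (rep x i.2) with he
  let S := (V : Filter (Finset ((U : Filter ℕ).Product M) × ℕ)).productSetoid
    fun i => N i.2 (img i.1 i.2)
  let φ : (U : Filter ℕ).Product M →[L]
      (V : Filter _).Product fun i : Finset ((U : Filter ℕ).Product M) × ℕ =>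
        N i.2 (img i.1 i.2) :=
    { toFun := fun x => Quotient.mk S (e x)
      map_fun' := by
        intro n f v
        refine Eq.trans ?_ (Ultraproduct.funMap_cast f fun i => e (v i)).symm
        refine Quotient.sound (s := S) (key _ ⟨insert (funMap f v) (Finset.univ.image v), fun F hF => ?_⟩)
        have hfv : ∀ᶠ k in (U : Filter ℕ), rep (funMap f v) k = funMap f fun i => rep (v i) k := by
          refine Quotient.exact (s := (U : Filter ℕ).productSetoid M)
            ((rep_spec (funMap f v)).trans ?_)
          refine Eq.trans ?_ (Ultraproduct.funMap_cast f fun i => rep (v i))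
          congr 1
          exact funext fun i => (rep_spec (v i)).symm
        filter_upwards [hfv, card_img F] with k hk hc
        have hmem : rep (funMap f v) k ∈ img F k :=
          mem_img k (hF (Finset.mem_insert_self _ _))
        simp only [he]
        rw [hk] at hmem ⊢
        exact hmap k _ hc f _ (fun i => mem_img k (hF (Finset.mem_insert_of_mem
          (Finset.mem_image_of_mem _ (Finset.mem_univ i))))) hmem
      map_rel' := fun {n} R => isEmptyElim R }
  refine Embedding.ofInjective (f := φ) fun x y hxy => ?_
  have hxy' : ∀ᶠ i in (V : Filter _), e x i = e y i :=
    Quotient.exact (s := S) hxy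
  by_contra hne
  have hne' : ∀ᶠ k in (U : Filter ℕ), rep x k ≠ rep y k := by
    refine Ultrafilter.eventually_not.2 fun heq => hne ?_
    rw [← rep_spec x, ← rep_spec y]
    exact Quotient.sound heq
  have : ∀ᶠ i in (V : Filter _), e x i ≠ e y i := by
    refine key _ ⟨{x, y}, fun F hF => ?_⟩
    filter_upwards [hne', card_img F] with k hk hc heq
    exact hk (hinj k _ hc (mem_img k (hF (by simp))) (mem_img k (hF (by simp))) heq)
  obtain ⟨i, h₁, h₂⟩ := (hxy'.and this).exists
  exact h₂ h₁

end FirstOrder.Language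

/-! ### Representability via embeddings. -/

namespace DomainRange

open Structure

theorem isRepresentable_iff_nonempty_embedding {M : Type u} [lang.Structure M] :
    IsRepresentable M ↔ ∃ X : Type u, Nonempty (M ↪[lang] Set (X × X)) := by
  constructor
  · rintro ⟨X, P, ⟨e⟩⟩
    exact ⟨X, ⟨P.subtype.comp e.toEmbedding⟩⟩
  · rintro ⟨X, ⟨e⟩⟩
    exact ⟨X, e.toHom.range, ⟨e.equivRange⟩⟩

theorem IsRepresentable.of_embedding {M N : Type u} [lang.Structure M] [lang.Structure N]
    (e : M ↪[lang] N) (h : IsRepresentable N) : IsRepresentable M := by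
  rw [isRepresentable_iff_nonempty_embedding] at h ⊢
  obtain ⟨X, ⟨g⟩⟩ := h
  exact ⟨X, ⟨g.comp e⟩⟩

instance : lang.IsAlgebraic := fun _ => inferInstanceAs (IsEmpty Empty)

end DomainRange

/-! ### The algebras and the relations representing them. -/

namespace DomainRange

open Structure

/-- The four objects of the category underlying `Alg`. -/
inductive Obj
  | X | Z | W | Y

/-- The elements of a category with zero whose objects are `Obj`, where the arrows `f : Z → W` and
`g : W → Z` satisfy `g * f = 1` and `f * g = ε`, and where `p i * q i = a i` and
`p i * ε * q i = a (t i)`. -/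
inductive Alg (A : Type u) (t : A → A) : Type u
  | zero
  | one (s : Obj)
  | f | g | ε
  | p (i : A) | pf (i : A) | pε (i : A)
  | q (i : A) | gq (i : A) | εq (i : A)
  | a (i : A)
  | top

namespace Alg

variable {A : Type u} {t : A → A}

/-- The source of an arrow. -/
def src : Alg A t → Option Obj
  | zero => none
  | one s => some s
  | f => some .Z
  | g => some .W
  | ε => some .Z
  | p _ => some .X
  | pf _ => some .X
  | pε _ => some .X
  | q _ => some .Z
  | gq _ => some .W
  | εq _ => some .Z
  | a _ => some .X
  | top => some .X

/-- The target of an arrow. -/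
def tgt : Alg A t → Option Obj
  | zero => none
  | one s => some s
  | f => some .W
  | g => some .Z
  | ε => some .Z
  | p _ => some .Z
  | pf _ => some .W
  | pε _ => some .Z
  | q _ => some .Y
  | gq _ => some .Y
  | εq _ => some .Y
  | a _ => some .Y
  | top => some .Y

/-- The zero or the identity arrow of an object. -/
def ofObj : Option Obj → Alg A t
  | none => zero
  | some s => one s

open Classical in
/-- Composition of arrows; it is zero unless the target of the first is the source of the
second. -/
noncomputable def comp : Alg A t → Alg A t → Alg A t
  | one s, y => if src y = some s then y else zero
  | x, one s => if tgt x = some s then x else zero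
  | p i, f => pf i
  | p i, ε => pε i
  | p i, q j => if i = j then a i else top
  | p i, εq j => if i = j then a (t i) else top
  | pf i, g => pε i
  | pf i, gq j => if i = j then a (t i) else top
  | pε i, f => pf i
  | pε i, ε => pε i
  | pε i, q j => if i = j then a (t i) else top
  | pε i, εq j => if i = j then a (t i) else top
  | ε, f => f
  | ε, ε => ε
  | ε, q i => εq i
  | ε, εq i => εq i
  | f, g => ε
  | f, gq i => εq i
  | g, f => one .W
  | g, ε => g
  | g, q i => gq i
  | g, εq i => gq i
  | _, _ => zero

noncomputable instance : lang.Structure (Alg A t) where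
  funMap := fun s =>
    match s with
    | Func.dom => fun v => ofObj (src (v 0))
    | Func.ran => fun v => ofObj (tgt (v 0))
    | Func.comp => fun v => comp (v 0) (v 1)
  RelMap := fun e => Empty.elim e

instance : Nonempty (Alg A t) := ⟨zero⟩

theorem comp_eq_zero (x y : Alg A t) (h : tgt x ≠ src y) : comp x y = zero := by
  cases x <;> cases y <;> simp_all [comp, src, tgt] <;> grind

theorem one_comp {s : Obj} {y : Alg A t} (h : src y = some s) : comp (one s) y = y := by
  simp [comp, h]

theorem comp_one {s : Obj} {x : Alg A t} (h : tgt x = some s) : comp x (one s) = x := by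
  cases x <;> simp_all [comp, src, tgt]

/-! ### A representation from an injective rank function -/

/-- Points of sort `W`. -/
structure PtW (r : A → ℕ) (t : A → A) where
  x : A → ℕ
  y : A → ℕ
  le : ∀ i, x i * y i ≤ r (t i)

/-- Points of sort `Z`. -/
structure PtZ (r : A → ℕ) (t : A → A) where
  w : PtW r t
  ξ : A → ℕ
  η : A → ℕ
  ξ_le : ∀ i, ξ i ≤ w.x i
  η_le : ∀ i, η i ≤ w.y i
  le : ∀ i, ξ i * η i ≤ r i

/-- The base of the representation. -/
inductive Pt (r : A → ℕ) (t : A → A)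
  | x (n : ℕ)
  | z (z : PtZ r t)
  | w (w : PtW r t)
  | y (n : ℕ)

variable {r : A → ℕ}

/-- The sort of a point. -/
def Pt.sort : Pt r t → Obj
  | x _ => .X
  | z _ => .Z
  | w _ => .W
  | y _ => .Y

/-- The relation represented by an element. -/
def rel : Alg A t → Pt r t → Pt r t → Prop
  | one s, b, c => b = c ∧ b.sort = s
  | f, .z z, .w w => z.w = w
  | g, .w w, .z z => w = z.w
  | ε, .z z, .z z' => z.w = z'.w
  | p i, .x n, .z z => n = z.ξ i
  | pf i, .x n, .w w => n ≤ w.x i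
  | pε i, .x n, .z z => n ≤ z.w.x i
  | q i, .z z, .y m => m = z.η i
  | gq i, .w w, .y m => m ≤ w.y i
  | εq i, .z z, .y m => m ≤ z.w.y i
  | a i, .x n, .y m => n * m ≤ r i
  | top, .x _, .y _ => True
  | _, _, _ => False

theorem Pt.exists {P : Pt r t → Prop} :
    (∃ b, P b) ↔ (∃ n, P (.x n)) ∨ (∃ z, P (.z z)) ∨ (∃ w, P (.w w)) ∨ ∃ n, P (.y n) := by
  constructor
  · rintro ⟨b, h⟩
    cases b
    exacts [.inl ⟨_, h⟩, .inr (.inl ⟨_, h⟩), .inr (.inr (.inl ⟨_, h⟩)), .inr (.inr (.inr ⟨_, h⟩))]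
  · rintro (⟨_, h⟩ | ⟨_, h⟩ | ⟨_, h⟩ | ⟨_, h⟩) <;> exact ⟨_, h⟩

open Classical in
theorem exists_ptW (i : A) {n m : ℕ} (h : n * m ≤ r (t i)) :
    ∃ w : PtW r t, w.x i = n ∧ w.y i = m := by
  refine ⟨⟨Pi.single i n, Pi.single i m, fun j => ?_⟩, by simp, by simp⟩
  obtain rfl | hj := eq_or_ne j i <;> simp [*]

open Classical in
theorem exists_ptZ_ξ (w : PtW r t) (i : A) {n : ℕ} (h : n ≤ w.x i) :
    ∃ z : PtZ r t, z.w = w ∧ n = z.ξ i := by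
  refine ⟨⟨w, Pi.single i n, 0, fun j => ?_, by simp, by simp⟩, rfl, by simp⟩
  obtain rfl | hj := eq_or_ne j i <;> simp [*]

open Classical in
theorem exists_ptZ_η (w : PtW r t) (i : A) {n : ℕ} (h : n ≤ w.y i) :
    ∃ z : PtZ r t, z.w = w ∧ n = z.η i := by
  refine ⟨⟨w, 0, Pi.single i n, by simp, fun j => ?_, by simp⟩, rfl, by simp⟩
  obtain rfl | hj := eq_or_ne j i <;> simp [*]

theorem exists_ptZ (w : PtW r t) : ∃ z : PtZ r t, z.w = w :=
  ⟨⟨w, 0, 0, by simp, by simp, by simp⟩, rfl⟩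

-- A `Z`-point sits over a `W`-point with coordinates at least as large, whose product is bounded by
-- `r (t i)`; this is where the rank must not drop along `t`.
open Classical in
theorem exists_ptZ_ξ_η (hr : ∀ i, r i ≤ r (t i)) (i : A) {n m : ℕ} (h : n * m ≤ r i) :
    ∃ z : PtZ r t, n = z.ξ i ∧ m = z.η i := by
  refine ⟨⟨⟨Pi.single i n, Pi.single i m, fun j => ?_⟩, Pi.single i n, Pi.single i m,
    fun _ => le_rfl, fun _ => le_rfl, fun j => ?_⟩, by simp, by simp⟩ <;>
  obtain rfl | hj := eq_or_ne j i
  exacts [by simpa using h.trans (hr j), by simp [hj], by simpa using h, by simp [hj] ]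

-- The bounds only couple coordinates with the same index, so distinct indices are independent. This
-- is why mixed products equal `top`.
open Classical in
theorem exists_ptZ_of_ne {i j : A} (hij : i ≠ j) (n m : ℕ) :
    ∃ z : PtZ r t, n = z.ξ i ∧ m = z.η j := by
  have h : ∀ k, (Pi.single i n : A → ℕ) k * (Pi.single j m : A → ℕ) k = 0 := by
    intro k
    obtain rfl | hk := eq_or_ne k i
    · simp [hij]
    · simp [hk]
  exact ⟨⟨⟨Pi.single i n, Pi.single j m, fun k => by simp [h]⟩, Pi.single i n, Pi.single j m,
    fun _ => le_rfl, fun _ => le_rfl, fun k => by simp [h]⟩, by simp, by simp⟩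

theorem rel_sort {x : Alg A t} {b c : Pt r t} (h : rel x b c) :
    src x = some b.sort ∧ tgt x = some c.sort := by
  cases x <;> cases b <;> cases c <;> simp_all [rel, src, tgt, Pt.sort]

theorem exists_ξ_and_w {w : PtW r t} {i : A} {n : ℕ} :
    (∃ z : PtZ r t, n = z.ξ i ∧ z.w = w) ↔ n ≤ w.x i := by
  constructor
  · rintro ⟨z, rfl, rfl⟩
    exact z.ξ_le i
  · intro h
    obtain ⟨z, h₁, h₂⟩ := exists_ptZ_ξ w i h
    exact ⟨z, h₂, h₁⟩

theorem exists_w_and_η {w : PtW r t} {i : A} {m : ℕ} :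
    (∃ z : PtZ r t, w = z.w ∧ m = z.η i) ↔ m ≤ w.y i := by
  constructor
  · rintro ⟨z, rfl, rfl⟩
    exact z.η_le i
  · intro h
    obtain ⟨z, h₁, h₂⟩ := exists_ptZ_η w i h
    exact ⟨z, h₁.symm, h₂⟩

theorem exists_w_and {w : PtW r t} {P : PtW r t → Prop} :
    (∃ z : PtZ r t, w = z.w ∧ P z.w) ↔ P w := by
  constructor
  · rintro ⟨z, rfl, h⟩
    exact h
  · intro h
    obtain ⟨z, rfl⟩ := exists_ptZ w
    exact ⟨z, rfl, h⟩

theorem exists_x_and_y {i : A} {n m : ℕ} :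
    (∃ w : PtW r t, n ≤ w.x i ∧ m ≤ w.y i) ↔ n * m ≤ r (t i) := by
  constructor
  · rintro ⟨w, h₁, h₂⟩
    exact (Nat.mul_le_mul h₁ h₂).trans (w.le i)
  · intro h
    obtain ⟨w, h₁, h₂⟩ := exists_ptW i h
    exact ⟨w, h₁.ge, h₂.ge⟩

theorem exists_ξ_and_y {i : A} {n m : ℕ} :
    (∃ z : PtZ r t, n = z.ξ i ∧ m ≤ z.w.y i) ↔ n * m ≤ r (t i) := by
  rw [← exists_x_and_y]
  constructor
  · rintro ⟨z, rfl, h⟩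
    exact ⟨z.w, z.ξ_le i, h⟩
  · rintro ⟨w, h₁, h₂⟩
    obtain ⟨z, rfl, h⟩ := exists_ptZ_ξ w i h₁
    exact ⟨z, h, h₂⟩

theorem exists_x_and_η {i : A} {n m : ℕ} :
    (∃ z : PtZ r t, n ≤ z.w.x i ∧ m = z.η i) ↔ n * m ≤ r (t i) := by
  rw [← exists_x_and_y]
  constructor
  · rintro ⟨z, h, rfl⟩
    exact ⟨z.w, h, z.η_le i⟩
  · rintro ⟨w, h₁, h₂⟩
    obtain ⟨z, rfl, h⟩ := exists_ptZ_η w i h₂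
    exact ⟨z, h₁, h⟩

theorem exists_w_x_and_w_y {i : A} {n m : ℕ} :
    (∃ z : PtZ r t, n ≤ z.w.x i ∧ m ≤ z.w.y i) ↔ n * m ≤ r (t i) := by
  rw [← exists_x_and_y]
  constructor
  · rintro ⟨z, h₁, h₂⟩
    exact ⟨z.w, h₁, h₂⟩
  · rintro ⟨w, h₁, h₂⟩
    obtain ⟨z, rfl⟩ := exists_ptZ w
    exact ⟨z, h₁, h₂⟩

theorem exists_ξ_and_η (hr : ∀ i, r i ≤ r (t i)) {i : A} {n m : ℕ} :
    (∃ z : PtZ r t, n = z.ξ i ∧ m = z.η i) ↔ n * m ≤ r i := by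
  constructor
  · rintro ⟨z, rfl, rfl⟩
    exact z.le i
  · exact exists_ptZ_ξ_η hr i

/-- Totality on the source sort is what makes the demonic condition automatic for matching arrows.
-/
theorem exists_rel_right (hr : ∀ i, r i ≤ r (t i)) {x : Alg A t} {b : Pt r t}
    (h : src x = some b.sort) : ∃ c, rel x b c := by
  cases x <;> cases b <;> simp_all [rel, src, Pt.sort, Pt.exists]
  case g.w w => exact (exists_ptZ w).imp fun _ h => h.symm
  case p.x i n =>
    obtain ⟨z, h, -⟩ := exists_ptZ_ξ_η hr i (n := n) (m := 0) (by simp)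
    exact ⟨z, h⟩
  case pf.x i n =>
    obtain ⟨w, h, -⟩ := exists_ptW (r := r) (t := t) i (n := n) (m := 0) (by simp)
    exact ⟨w, h.ge⟩
  case pε.x i n =>
    obtain ⟨z, h, -⟩ := exists_ptZ_ξ_η hr i (n := n) (m := 0) (by simp)
    exact ⟨z, h.le.trans (z.ξ_le i)⟩
  all_goals exact ⟨0, by simp⟩

theorem exists_rel_left (hr : ∀ i, r i ≤ r (t i)) {x : Alg A t} {c : Pt r t}
    (h : tgt x = some c.sort) : ∃ b, rel x b c := by
  cases x <;> cases c <;> simp_all [rel, tgt, Pt.sort, Pt.exists]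
  case f.w w => exact exists_ptZ w
  case q.y i n =>
    obtain ⟨z, -, h⟩ := exists_ptZ_ξ_η hr i (n := 0) (m := n) (by simp)
    exact ⟨z, h⟩
  case gq.y i n =>
    obtain ⟨w, -, h⟩ := exists_ptW (r := r) (t := t) i (n := 0) (m := n) (by simp)
    exact ⟨w, h.ge⟩
  case εq.y i n =>
    obtain ⟨z, -, h⟩ := exists_ptZ_ξ_η hr i (n := 0) (m := n) (by simp)
    exact ⟨z, h.le.trans (z.η_le i)⟩
  all_goals exact ⟨0, by simp⟩

theorem src_comp {x y : Alg A t} (h : tgt x = src y) : src (comp x y) = src x := by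
  cases x <;> cases y <;> simp_all [comp, src, tgt] <;> split_ifs <;> rfl

theorem tgt_comp {x y : Alg A t} (h : tgt x = src y) : tgt (comp x y) = tgt y := by
  cases x <;> cases y <;> simp_all [comp, src, tgt] <;> split_ifs <;> rfl

-- Through a `Z`-point with both coordinates exact the bound is `r i`; once either is relaxed to an
-- inequality in the underlying `W`-point, the bound becomes `r (t i)`.
set_option maxHeartbeats 1000000 in
theorem exists_rel_comp (hr : ∀ i, r i ≤ r (t i)) {x y : Alg A t} {b d : Pt r t}
    (h : tgt x = src y) : (∃ c, rel x b c ∧ rel y c d) ↔ rel (comp x y) b d := by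
  by_cases hb : src x = some b.sort
  swap
  · refine iff_of_false (fun ⟨c, h₁, _⟩ => hb (rel_sort h₁).1) fun h' => hb ?_
    rw [← src_comp h, (rel_sort h').1]
  by_cases hd : tgt y = some d.sort
  swap
  · refine iff_of_false (fun ⟨c, _, h₁⟩ => hd (rel_sort h₁).2) fun h' => hd ?_
    rw [← tgt_comp h, (rel_sort h').2]
  by_cases hx : ∃ s, x = one s
  · obtain ⟨s, rfl⟩ := hx
    rw [one_comp h.symm]
    constructor
    · rintro ⟨c, ⟨rfl, -⟩, h⟩
      exact h
    · intro h'
      exact ⟨b, ⟨rfl, (Option.some.inj hb).symm⟩, h'⟩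
  by_cases hy : ∃ s, y = one s
  · obtain ⟨s, rfl⟩ := hy
    rw [comp_one h]
    constructor
    · rintro ⟨c, h, rfl, -⟩
      exact h
    · intro h'
      exact ⟨d, h', rfl, (Option.some.inj hd).symm⟩
  have hne : ∀ {i j : A} (n m : ℕ), i ≠ j → (∃ z : PtZ r t, n = z.ξ i ∧ m = z.η j) ∧
      (∃ z : PtZ r t, n = z.ξ i ∧ m ≤ z.w.y j) ∧ (∃ z : PtZ r t, n ≤ z.w.x i ∧ m = z.η j) ∧
      (∃ z : PtZ r t, n ≤ z.w.x i ∧ m ≤ z.w.y j) ∧ (∃ w : PtW r t, n ≤ w.x i ∧ m ≤ w.y j) := by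
    intro i j n m hij
    obtain ⟨z, h₁, h₂⟩ := exists_ptZ_of_ne (r := r) (t := t) hij n m
    have h₃ := h₁.le.trans (z.ξ_le i)
    have h₄ := h₂.le.trans (z.η_le j)
    exact ⟨⟨z, h₁, h₂⟩, ⟨z, h₁, h₄⟩, ⟨z, h₃, h₂⟩, ⟨z, h₃, h₄⟩, ⟨z.w, h₃, h₄⟩⟩
  have hxw : ∀ (w : PtW r t) (i : A) (n : ℕ),
      (∃ z : PtZ r t, n ≤ z.w.x i ∧ z.w = w) ↔ n ≤ w.x i := fun w i n => by
    simpa only [and_comm, eq_comm] using exists_w_and (w := w) (P := (n ≤ PtW.x · i))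
  cases x <;> cases y <;> simp [src, tgt] at h hx hy hb hd <;> cases b <;>
    simp [Pt.sort] at hb <;> cases d <;> simp [Pt.sort] at hd <;>
    simp only [comp] <;> (try split_ifs with hij) <;>
    simp only [rel, Pt.exists, and_false, exists_false, or_false, false_or, iff_true]
  all_goals first
    | exact (hne _ _ hij).1
    | exact (hne _ _ hij).2.1
    | exact (hne _ _ hij).2.2.1
    | exact (hne _ _ hij).2.2.2.1
    | exact (hne _ _ hij).2.2.2.2
    | (subst hij; first
        | exact exists_ξ_and_η hr
        | exact exists_ξ_and_y
        | exact exists_x_and_η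
        | exact exists_w_x_and_w_y
        | exact exists_x_and_y)
    | exact exists_ξ_and_w
    | exact exists_w_and_η
    | exact exists_w_and (P := (· = _))
    | exact exists_w_and (P := (_ ≤ PtW.y · _))
    | exact hxw _ _ _
    | (simp [Pt.sort]; done)
    | (simp only [Pt.sort, Pt.w.injEq, and_true]; exact exists_w_and (P := (· = _)))

end Alg
end DomainRange

/-! ### Faithfulness of the representation. -/

namespace DomainRange

open Structure

namespace Alg

variable {A : Type u} {t : A → A} {r : A → ℕ}

/-- The set of pairs represented by an element. -/
def rep (r : A → ℕ) (x : Alg A t) : Set (Pt r t × Pt r t) :=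
  {b | rel x b.1 b.2}

theorem rel_ofObj {o : Option Obj} {b c : Pt r t} :
    rel (ofObj o : Alg A t) b c ↔ b = c ∧ o = some b.sort := by
  cases o
  · simp [ofObj, rel]
  · simp [ofObj, rel, eq_comm]

theorem domRel_rep (hr : ∀ i, r i ≤ r (t i)) (x : Alg A t) :
    domRel (rep r x) = rep r (ofObj (src x) : Alg A t) := by
  ext ⟨b, c⟩
  refine Iff.trans (and_congr_right fun _ => ?_) rel_ofObj.symm
  exact ⟨fun ⟨_, h⟩ => (rel_sort h).1, exists_rel_right hr⟩

theorem ranRel_rep (hr : ∀ i, r i ≤ r (t i)) (x : Alg A t) :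
    ranRel (rep r x) = rep r (ofObj (tgt x) : Alg A t) := by
  ext ⟨b, c⟩
  refine Iff.trans (and_congr_right fun (h : b = c) => ?_) rel_ofObj.symm
  subst h
  exact ⟨fun ⟨_, h⟩ => (rel_sort h).2, exists_rel_left hr⟩

theorem demonicComp_rep (hr : ∀ i, r i ≤ r (t i)) (x y : Alg A t) :
    demonicComp (rep r x) (rep r y) = rep r (comp x y) := by
  ext ⟨b, d⟩
  by_cases h : tgt x = src y
  · refine Iff.trans ⟨fun h' => h'.1, fun h' => ⟨h', fun c hc => ?_⟩⟩ (exists_rel_comp hr h)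
    exact ⟨rfl, exists_rel_right hr (h.symm.trans (rel_sort hc).2)⟩
  · rw [comp_eq_zero x y h]
    refine iff_of_false ?_ id
    rintro ⟨⟨c, h₁, h₂⟩, -⟩
    exact h ((rel_sort h₁).2.trans (rel_sort h₂).1.symm)

theorem src_eq_of_rep_eq (hr : ∀ i, r i ≤ r (t i)) {x y : Alg A t} (h : rep r x = rep r y) :
    src x = src y := by
  have key : ∀ {x y : Alg A t}, rep r x = rep r y → ∀ s, src x = some s → src y = some s := by
    intro x y h s hs
    obtain ⟨b, rfl⟩ : ∃ b : Pt r t, b.sort = s := by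
      have w : PtW r t := ⟨0, 0, by simp⟩
      obtain ⟨z, -⟩ := exists_ptZ w
      cases s
      exacts [⟨.x 0, rfl⟩, ⟨.z z, rfl⟩, ⟨.w w, rfl⟩, ⟨.y 0, rfl⟩]
    obtain ⟨c, hc⟩ := exists_rel_right hr hs
    exact (rel_sort (show (b, c) ∈ rep r y from h ▸ hc)).1
  exact Option.ext fun s => ⟨key h s, key h.symm s⟩

theorem tgt_eq_of_rep_eq (hr : ∀ i, r i ≤ r (t i)) {x y : Alg A t} (h : rep r x = rep r y) :
    tgt x = tgt y := by
  have key : ∀ {x y : Alg A t}, rep r x = rep r y → ∀ s, tgt x = some s → tgt y = some s := by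
    intro x y h s hs
    obtain ⟨b, rfl⟩ : ∃ b : Pt r t, b.sort = s := by
      have w : PtW r t := ⟨0, 0, by simp⟩
      obtain ⟨z, -⟩ := exists_ptZ w
      cases s
      exacts [⟨.x 0, rfl⟩, ⟨.z z, rfl⟩, ⟨.w w, rfl⟩, ⟨.y 0, rfl⟩]
    obtain ⟨c, hc⟩ := exists_rel_left hr hs
    exact (rel_sort (show (c, b) ∈ rep r y from h ▸ hc)).2
  exact Option.ext fun s => ⟨key h s, key h.symm s⟩

open Classical in
theorem rep_injective [Nonempty A] (hinj : Function.Injective r) (hr : ∀ i, r i ≤ r (t i)) :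
    Function.Injective (rep r : Alg A t → _) := by
  intro x y h
  have hs := src_eq_of_rep_eq hr h
  have ht := tgt_eq_of_rep_eq hr h
  have hrel : ∀ b c, rel x b c ↔ rel y b c := fun b c =>
    ⟨fun hb => show (b, c) ∈ rep r y from h ▸ hb, fun hb => show (b, c) ∈ rep r x from h ▸ hb⟩
  -- Unit vectors detect the index. The primed points have the same `W`-point but zero `ξ` and `η`,
  -- which separates `p` from `pε`, `q` from `εq` and the identity from `ε`.
  let wx (i : A) : PtW r t := ⟨Pi.single i 1, 0, by simp⟩
  let wy (i : A) : PtW r t := ⟨0, Pi.single i 1, by simp⟩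
  let zx (i : A) : PtZ r t := ⟨wx i, Pi.single i 1, 0, fun _ => le_rfl, by simp, by simp⟩
  let zy (i : A) : PtZ r t := ⟨wy i, 0, Pi.single i 1, by simp, fun _ => le_rfl, by simp⟩
  let zx' (i : A) : PtZ r t := ⟨wx i, 0, 0, by simp, by simp [wx], by simp⟩
  let zy' (i : A) : PtZ r t := ⟨wy i, 0, 0, by simp [wy], by simp, by simp⟩
  have single : ∀ {i j : A}, 1 ≤ (Pi.single i 1 : A → ℕ) j → i = j := by
    intro i j hij
    by_contra hne
    simp [Pi.single_eq_of_ne (Ne.symm hne)] at hij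
  have single' : ∀ {i j : A}, 1 = (Pi.single i 1 : A → ℕ) j → i = j := fun h => single h.le
  obtain ⟨i₀⟩ := ‹Nonempty A›
  have key : ∀ {x y : Alg A t}, (∀ b c : Pt r t, rel x b c ↔ rel y b c) →
      match x, y with
      | one _, ε => False
      | p i, p j | pε i, pε j | pf i, pf j | q i, q j | εq i, εq j | gq i, gq j => i = j
      | p _, pε _ | q _, εq _ | a _, top => False
      | a i, a j => r i ≤ r j
      | _, _ => True := by
    intro x y h
    split
    · simpa [rel, zx, zx', funext_iff, Pi.single_apply] using h (.z (zx i₀)) (.z (zx' i₀))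
    · exact single' ((h (.x 1) (.z (zx _))).1 (by simp [rel, zx]))
    · exact single ((h (.x 1) (.z (zx _))).1 (by simp [rel, zx, wx]))
    · exact single ((h (.x 1) (.w (wx _))).1 (by simp [rel, wx]))
    · exact single' ((h (.z (zy _)) (.y 1)).1 (by simp [rel, zy]))
    · exact single ((h (.z (zy _)) (.y 1)).1 (by simp [rel, zy, wy]))
    · exact single ((h (.w (wy _)) (.y 1)).1 (by simp [rel, wy]))
    · rename_i i j
      simpa [rel, zx', wx] using h (.x 1) (.z (zx' j))
    · rename_i i j
      simpa [rel, zy', wy] using h (.z (zy' j)) (.y 1)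
    · rename_i i
      -- With first coordinate 1, the relation of `a i` reads `m ≤ r i`, so it determines `r i`.
      simpa [rel] using h (.x 1) (.y (r i + 1))
    · rename_i i j
      simpa [rel] using h (.x 1) (.y (r i))
    · trivial
  have h₁ := key hrel
  have h₂ := key fun b c => (hrel b c).symm
  have ha : ∀ {i j}, r i ≤ r j → r j ≤ r i → i = j := fun h h' => hinj (le_antisymm h h')
  clear hrel h key hr hinj
  cases x <;> cases y <;> simp only [src, tgt, Option.some.injEq, reduceCtorEq] at hs ht <;>
    first
      | rfl
      | exact h₁.elim
      | exact h₂.elim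
      | exact congrArg _ hs
      | exact congrArg _ h₁
      | exact congrArg _ (ha h₁ h₂)
      | (subst hs; cases ht)

theorem isRepresentable_of_rank [Nonempty A] (hinj : Function.Injective r)
    (hr : ∀ i, r i ≤ r (t i)) : IsRepresentable (Alg A t) := by
  rw [isRepresentable_iff_nonempty_embedding]
  refine ⟨Pt r t, ⟨⟨⟨rep r, rep_injective hinj hr⟩, fun f v => ?_, fun R => isEmptyElim R⟩⟩⟩
  cases f
  exacts [(domRel_rep hr _).symm, (ranRel_rep hr _).symm, (demonicComp_rep hr _ _).symm]

end Alg

end DomainRange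

namespace DomainRange

open Structure

namespace Alg

/-! ### Representations force inclusions -/

section Embedding

variable {A : Type u} {t : A → A} {X : Type*} (e : Alg A t ↪[lang] Set (X × X))

theorem domRel_map (x : Alg A t) : domRel (e x) = e (ofObj (src x)) :=
  (e.map_fun (Func.dom : lang.Functions 1) ![x]).symm

theorem ranRel_map (x : Alg A t) : ranRel (e x) = e (ofObj (tgt x)) :=
  (e.map_fun (Func.ran : lang.Functions 1) ![x]).symm

theorem demonicComp_map (x y : Alg A t) : demonicComp (e x) (e y) = e (comp x y) :=
  (e.map_fun (Func.comp : lang.Functions 2) ![x, y]).symm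

variable {e}

theorem eq_of_mem_map_one {s : Obj} {b c : X} (h : (b, c) ∈ e (one s)) : b = c := by
  have h' := domRel_map e (one s)
  rw [show (ofObj (src (one s)) : Alg A t) = one s from rfl] at h'
  rw [← h'] at h
  exact h.1

/-- The range of `e x` and the domain of `e y` are both `e (one s)`. -/
theorem exists_mem_map_of_tgt_eq_src {x y : Alg A t} {s : Obj} (hx : tgt x = some s)
    (hy : src y = some s) {b c : X} (h : (b, c) ∈ e x) : ∃ d, (c, d) ∈ e y := by
  have h' : (c, c) ∈ e (ofObj (tgt x)) := by
    rw [← ranRel_map]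
    exact ⟨rfl, b, h⟩
  rw [hx, ← hy, ← domRel_map] at h'
  exact h'.2

theorem exists_mem_map_of_src_eq_tgt {x y : Alg A t} {s : Obj} (hx : src x = some s)
    (hy : tgt y = some s) {b c : X} (h : (b, c) ∈ e x) : ∃ d, (d, b) ∈ e y := by
  have h' : (b, b) ∈ e (ofObj (src x)) := by
    rw [← domRel_map]
    exact ⟨rfl, c, h⟩
  rw [hx, ← hy, ← ranRel_map] at h'
  exact h'.2

/-- Every `e x`-successor lies in the domain of `e y`, so demonic composition is ordinary
composition here. -/
theorem mem_map_comp {x y : Alg A t} {s : Obj} (hx : tgt x = some s) (hy : src y = some s)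
    {b c d : X} (h : (b, c) ∈ e x) (h' : (c, d) ∈ e y) : (b, d) ∈ e (comp x y) := by
  rw [← demonicComp_map]
  exact ⟨⟨c, h, h'⟩, fun z hz => ⟨rfl, exists_mem_map_of_tgt_eq_src hx hy hz⟩⟩

/-- Since `g` is the converse of the function `f`, the element `ε` contains the identity on `Z`. -/
theorem mem_map_ε {x : Alg A t} (hx : tgt x = some .Z) {b c : X} (h : (b, c) ∈ e x) :
    (c, c) ∈ e ε := by
  obtain ⟨w, hw⟩ := exists_mem_map_of_tgt_eq_src (y := f) hx rfl h
  obtain ⟨v, hv⟩ := exists_mem_map_of_src_eq_tgt (x := f) (y := g) rfl rfl hw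
  obtain rfl : v = w := eq_of_mem_map_one (s := .W)
    (mem_map_comp (x := g) (y := f) (s := .Z) rfl rfl hv hw)
  exact mem_map_comp (x := f) (y := g) (s := .W) rfl rfl hw hv

theorem map_a_subset (i : A) : e (a i) ⊆ e (a (t i)) := by
  rintro ⟨b, d⟩ h
  have h' := demonicComp_map e (p i) (q i)
  simp only [comp, if_true] at h'
  rw [← h'] at h
  obtain ⟨⟨c, hp, hq⟩, -⟩ := h
  have hpε := mem_map_comp (s := .Z) rfl rfl hp (mem_map_ε rfl hp)
  have := mem_map_comp (x := pε i) (s := .Z) rfl rfl hpε hq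
  simpa only [comp, if_true] using this

end Embedding

/-- Going round the cycle gives both inclusions between the images of `a i` and `a (t i)`, which are
distinct elements. -/
theorem not_isRepresentable_of_cycle {A : Type u} {t : A → A} {i : A} {n : ℕ}
    (hn : t^[n] (t i) = i) (hi : t i ≠ i) : ¬ IsRepresentable (Alg A t) := by
  rw [isRepresentable_iff_nonempty_embedding]
  rintro ⟨X, ⟨e⟩⟩
  have key : ∀ n j, e (a j) ⊆ e (a (t^[n] j)) := by
    intro n
    induction n with
    | zero => exact fun _ => subset_rfl
    | succ n ih => exact fun j => (map_a_subset j).trans (ih _)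
  have h := key n (t i)
  rw [hn] at h
  have := e.injective ((map_a_subset i).antisymm h)
  injection this with this
  exact hi this.symm

/-! ### Changing one value of `t` -/

section Relabel

variable {A : Type u} {t t' : A → A}

/-- The identity map, for different values of `t`. -/
def relabel (t' : A → A) : Alg A t → Alg A t'
  | zero => zero
  | one s => one s
  | f => f
  | g => g
  | ε => ε
  | p i => p i
  | pf i => pf i
  | pε i => pε i
  | q i => q i
  | gq i => gq i
  | εq i => εq i
  | a i => a i
  | top => top

/-- The index of an element `p i`, `p i * f` or `p i * ε`. -/
def index : Alg A t → Option A
  | p i => some i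
  | pf i => some i
  | pε i => some i
  | _ => none

theorem relabel_injective : Function.Injective (relabel t' : Alg A t → Alg A t') :=
  Function.LeftInverse.injective (g := relabel t) fun x => by cases x <;> rfl

theorem src_relabel (x : Alg A t) : src (relabel t' x) = src x := by
  cases x <;> rfl

theorem tgt_relabel (x : Alg A t) : tgt (relabel t' x) = tgt x := by
  cases x <;> rfl

theorem relabel_ofObj (o : Option Obj) : relabel t' (ofObj o : Alg A t) = ofObj o := by
  cases o <;> rfl

/-- A value `t i` enters the composition table only when the left factor is `p i`, `pf i` or `pε i`.
-/
theorem relabel_comp {x : Alg A t} (h : ∀ i, index x = some i → t i = t' i) (y : Alg A t) :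
    relabel t' (comp x y) = comp (relabel t' x) (relabel t' y) := by
  cases x <;> cases y <;> simp [index] at h <;> simp only [comp, relabel, src, tgt] <;>
    (try split_ifs) <;> (try subst_vars) <;> simp_all

end Relabel

/-! ### The cyclic structures -/

/-- The cyclic successor. -/
def cyc (k : ℕ) (i : ULift.{u} (Fin (k + 2))) : ULift.{u} (Fin (k + 2)) := ⟨i.down + 1⟩

theorem not_isRepresentable_cyc (k : ℕ) : ¬ IsRepresentable (Alg _ (cyc.{u} k)) := by
  refine not_isRepresentable_of_cycle (i := ⟨0⟩) (n := k + 1) ?_ ?_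
  · rw [← Function.iterate_succ_apply]
    have : ∀ n : ℕ, (cyc.{u} k)^[n] ⟨0⟩ = ⟨Fin.ofNat (k + 2) n⟩ := by
      intro n
      induction n with
      | zero => rfl
      | succ n ih => rw [Function.iterate_succ_apply', ih, cyc]; ext; simp [Fin.val_add]
    rw [this]
    exact congrArg _ (Fin.ext (Nat.mod_self (k + 2)))
  · intro h
    simpa [cyc] using congrArg ULift.down h

open Classical in
theorem isRepresentable_update_cyc (k : ℕ) (i : ULift.{u} (Fin (k + 2))) :
    IsRepresentable (Alg _ (Function.update (cyc.{u} k) i i)) := by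
  -- The cut cycle is numbered from `i + 1`, of rank 0, round to the fixed point `i`, of rank `k +
  -- 1`; each other step raises the rank by one.
  refine isRepresentable_of_rank (r := fun j => (j.down - (i.down + 1)).val) ?_ ?_
  · intro j j' h
    exact ULift.down_injective (sub_left_injective (Fin.val_injective h))
  · intro j
    obtain rfl | hj := eq_or_ne j i
    · simp
    · have hne : j.down - i.down ≠ 0 := fun h => hj (ULift.down_injective (sub_eq_zero.1 h))
      have h₁ : j.down - (i.down + 1) = j.down - i.down - 1 := by abel
      have h₂ : j.down + 1 - (i.down + 1) = j.down - i.down := by abel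
      simp only [Function.update_of_ne hj, cyc]
      rw [h₁, h₂, Fin.val_sub_one_of_ne_zero hne]
      exact Nat.sub_le _ _

/-- Each element carries at most one of the `k + 2` indices. -/
theorem exists_index_ne {k : ℕ} (F : Finset (Alg _ (cyc.{u} k))) (hF : F.card ≤ k) :
    ∃ i, ∀ x ∈ F, index x ≠ some i := by
  classical
  obtain ⟨o, ho, hF'⟩ := Finset.exists_mem_notMem_of_card_lt_card
    (s := F.image index) (t := Finset.univ.image some) <| by
      rw [Finset.card_image_of_injective _ (Option.some_injective _)]
      refine (Finset.card_image_le.trans hF).trans_lt ?_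
      simp
  obtain ⟨i, -, rfl⟩ := Finset.mem_image.1 ho
  exact ⟨i, fun x hx h => hF' (Finset.mem_image.2 ⟨x, hx, h⟩)⟩

end Alg

end DomainRange

/-! ### Non-finite axiomatisability. -/

open DomainRange in
theorem mainTheorem1 :
    ¬ ∃ T : DomainRange.lang.Theory, T.Finite ∧
      ∀ (M : Type*) [Nonempty M] [DomainRange.lang.Structure M],
        M ⊨ T ↔ DomainRange.IsRepresentable M := by
  classical
  rintro ⟨T, hfin, hT⟩
  have hex : ∀ (k : ℕ) (F : Finset (Alg _ (Alg.cyc k))),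
      ∃ i, F.card ≤ k → ∀ x ∈ F, Alg.index x ≠ some i := fun k F => by
    by_cases h : F.card ≤ k
    · obtain ⟨i, hi⟩ := Alg.exists_index_ne F h
      exact ⟨i, fun _ => hi⟩
    · exact ⟨⟨0⟩, fun h' => absurd h' h⟩
  choose m hm using hex
  obtain ⟨ι, V, s, ⟨e⟩⟩ := exists_ultraproduct_embedding_of_locally (L := lang)
    (M := fun k => Alg _ (Alg.cyc k)) (Filter.hyperfilter ℕ) Nat.hyperfilter_le_atTop
    (fun k F => Alg _ (Function.update (Alg.cyc k) (m k F) (m k F))) (fun k F => Alg.relabel _)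
    (fun k F _ => Alg.relabel_injective.injOn) (by
      intro k F hF n f v hv _
      cases f
      · exact (Alg.relabel_ofObj _).trans (congrArg _ (Alg.src_relabel _).symm)
      · exact (Alg.relabel_ofObj _).trans (congrArg _ (Alg.tgt_relabel _).symm)
      · refine Alg.relabel_comp (fun i hi => ?_) _
        rw [Function.update_of_ne]
        rintro rfl
        exact hm k F hF _ (hv 0) hi)
  have hV : (V : Filter ι).Product (fun i => Alg _ (Function.update (Alg.cyc (s i).1)
      (m (s i).1 (s i).2) (m (s i).1 (s i).2))) ⊨ T := by
    refine Theory.model_iff _ |>.2 fun φ hφ => (Ultraproduct.sentence_realize φ).2 ?_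
    exact .of_forall fun i =>
      ((hT _).2 (Alg.isRepresentable_update_cyc _ _)).realize_of_mem φ hφ
  have hU := (hT _).2 (((hT _).1 hV).of_embedding e)
  -- Finiteness of `T` lets one factor satisfy all its sentences at once.
  have hev : ∀ᶠ k in (Filter.hyperfilter ℕ : Filter ℕ), ∀ φ ∈ T, Alg _ (Alg.cyc k) ⊨ φ :=
    (Filter.eventually_all_finite hfin).2 fun φ hφ =>
      (Ultraproduct.sentence_realize φ).1 (hU.realize_of_mem φ hφ)
  obtain ⟨k, hk⟩ := hev.exists
  exact Alg.not_isRepresentable_cyc k ((hT _).1 (Theory.model_iff _ |>.2 hk))
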